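/- **Setting.** Let $G=(V,E)$ be a finite undirected graph with $n=|V|\ge 3$ vertices and positive real edge weights. Write $|P|$ for the weighted length of a path $P$, $P[x,y]$ for its part from $x$ to $y$, and $\delta_{G'}(x,y)\in[0,\infty]$ for the distance in a subgraph $G'$. For $R\subseteq V$ let $G-R$ be the subgraph induced by $V\setminus R$. Put $k=\ln n$, let $d\ge 2$ be an integer, let $c\ge 1$ be real, and let $\sigma=4e\,d^{c+1}\ln^2 n+1$. **Tree covers.** For all $R,S\subseteq V$ let $\mathcal T_R(S)$ be an $(S\setminus R)$-restricted tree cover of $G-R$. This is a family of rooted trees $\{T(r): r\in S\setminus R\}$ that are subgraphs of $G-R$, with $T(r)$ rooted at $r$, such that - for all $a\in S\setminus R$ and $b\in V\setminus R$ that are connected in $G-R$ there is $r\in S\setminus R$ with $a,b\in V(T(r))$ and $\mathrm{dep}_{T(r)}(a)+\mathrm{dep}_{T(r)}(b)\le(2k-1)\,\delta_{G-R}(a,b)$, where $\mathrm{dep}_T(x)$ is the weighted distance in $T$ from $x$ to the root; - every vertex of $G-R$ is in at most $2e\ln^2 n$ of the trees. The trunk vertices of $T\in\mathcal T_R(S)$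 are the vertices on tree paths between two vertices of $S\setminus R$ in $T$. The pseudo-degree of $v$ in $T$ is its degree in the subgraph of $T$ induced by the trunk vertices ($0$ if $v$ is not a trunk vertex). $\mathrm{Hi}(\mathcal T_R(S))$ is the set of vertices that have pseudo-degree $>\sigma$ in some tree of $\mathcal T_R(S)$. **Hierarchy and levels.** The hierarchy tree is the rooted tree whose nodes are subsets of $V$, with root $V$. A node $A$ is a leaf if $\mathrm{Hi}(\mathcal T_\varnothing(A))=\varnothing$; otherwise its children are $W_1,\dots,W_d$, where $W_0=\varnothing$ and $W_{j+1}=W_j\cup\mathrm{Hi}(\mathcal T_{W_j}(A))$. Let $V=U_1,U_2,\dots,U_p$ ($p\ge1$) be any path in this tree that starts at the root and goes from each node to one of its children, and put $U_{p+1}=\varnothing$. The level of a vertex $v$ is the largest $l\le p$ with $v\in U_l$, and $G_i$ is the subgraph of $G$ induced by the vertices of level at most $i$. **The set $V(H)$.** Let $D\subseteq V$ with $|D|\le d$, and let $s,t\in V\setminus D$. For $f\in D$ let $N(f)$ consist of, for every tree $T\in\bigcup_{i=1}^p\mathcal T_{U_{i+1}}(U_i)$ that contains $f$, the parent of $f$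 in $T$ (if $f$ is not the root) and all children of $f$ in $T$ that are trunk vertices of $T$. Let $V(H)=\bigl(\{s,t\}\cup\bigcup_{f\in D}N(f)\bigr)\setminus D$. **Far paths and segments.** Let $P$ be a path from $u$ to $v$ and let $\eta>0$. - $P$ is $\eta$-far from $V(H)$ if there are no vertices $x\in P\setminus\{u,v\}$ and $w\in V(H)$ with $\delta_{G-D}(x,w)\le\eta\cdot\min\{|P[u,x]|,|P[x,v]|\}$. - Two vertices $x,y\in P\setminus\{u,v\}$ are in the same $\eta$-segment of $P$ if either $|P[u,x]|,|P[u,y]|\le|P|/2$ and $\lfloor\log_{1+\eta}|P[u,x]|\rfloor=\lfloor\log_{1+\eta}|P[u,y]|\rfloor$, or $|P[x,v]|,|P[y,v]|<|P|/2$ and $\lfloor\log_{1+\eta}|P[x,v]|\rfloor=\lfloor\log_{1+\eta}|P[y,v]|\rfloor$. The $\eta$-segments of $P$ are the subpaths $P[x,y]$ from the first to the last vertex of an equivalence class. - $P$ is an $\eta$-segment expath if for each of its $\eta$-segments $P[x,y]$ there is $1\le i\le p$ such that $P[x,y]$ is a shortest path in $G_i$. **Theorem.** Let $\epsilon>0$,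 $u,v\in V(H)$, $\epsilon_3=\epsilon/(2|V(H)|)$ and $\epsilon_4=\epsilon_3/(4k-2)$. Let $P=\pi_{G-D}(u,v)$ be a shortest path from $u$ to $v$ in $G-D$. If $P$ is $\epsilon_3$-far from $V(H)$, then $P$ is an $\epsilon_4$-segment expath. -/

import Mathlib

open scoped ENNReal

namespace VSDO

noncomputable section

/-- Weighted length `|p|` of a walk, for edge weights `wt`. -/
def wlen {V : Type*} {G : SimpleGraph V} (wt : Sym2 V → ℝ) {x y : V} (p : G.Walk x y) : ℝ :=
  (p.edges.map wt).sum

/-- The walk `p` stays inside the induced subgraph `G[A]`. -/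
def StaysIn {V : Type*} {G : SimpleGraph V} (A : Set V) {x y : V} (p : G.Walk x y) : Prop :=
  ∀ z ∈ p.support, z ∈ A

/-- Weighted distance from `x` to `y` in the induced subgraph `G[A]`
(`⊤` if `x`, `y` are not connected in `G[A]`, in particular if one of them is not in `A`). -/
def wdist {V : Type*} (G : SimpleGraph V) (wt : Sym2 V → ℝ) (A : Set V) (x y : V) : ℝ≥0∞ :=
  ⨅ p : {p : G.Walk x y // StaysIn A p}, ENNReal.ofReal (wlen wt p.1)

/-- `p` is a shortest path in the induced subgraph `G[A]`. (Weights are positive, so it makes no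
difference whether `p` is compared with all paths or with all walks of `G[A]`.) -/
def IsShortestPathIn {V : Type*} {G : SimpleGraph V} (wt : Sym2 V → ℝ) (A : Set V) {x y : V}
    (p : G.Walk x y) : Prop :=
  p.IsPath ∧ StaysIn A p ∧ ∀ q : G.Walk x y, StaysIn A q → wlen wt p ≤ wlen wt q

/-! Rooted trees. A tree on a subset of `V` with root `r` is stored as a graph `T` on `V`, all of
whose edges lie in the connected component of `r`; its vertex set is that component. -/

/-- The vertex set `V(T)` of the tree `T` with root `r`. -/
def treeVerts {V : Type*} (T : SimpleGraph V) (r : V) : Set V := {v | T.Reachable r v}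

/-- `T` is a tree with root `r`, contained in the induced subgraph `G[A]`. -/
structure IsRootedTreeIn {V : Type*} (G : SimpleGraph V) (A : Set V) (T : SimpleGraph V) (r : V) : Prop where
  le : T ≤ G
  acyclic : T.IsAcyclic
  mem_of_adj : ∀ x y, T.Adj x y → x ∈ treeVerts T r
  verts_subset : treeVerts T r ⊆ A

/-- Weighted depth of `x` in the tree `T` with root `r` (`⊤` if `x` is not in the tree). -/
def depth {V : Type*} (wt : Sym2 V → ℝ) (T : SimpleGraph V) (r x : V) : ℝ≥0∞ :=
  wdist T wt Set.univ x r

/-- In the tree `T` with root `r`, the vertex `a` is the parent of `b`: it is the neighbour of `b`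
on the tree path from the root to `b`. -/
def IsParent {V : Type*} (T : SimpleGraph V) (r a b : V) : Prop :=
  T.Adj a b ∧ ∃ q : T.Walk r b, q.IsPath ∧ a ∈ q.support

/-- The trunk vertices of the tree `T` with root `r`, relative to the source set `S`:
the vertices that lie on the tree path between two vertices of `S`. -/
def trunk {V : Type*} (S : Set V) (T : SimpleGraph V) (r : V) : Set V :=
  {v | v ∈ treeVerts T r ∧
    ∃ a ∈ S, ∃ b ∈ S, ∃ q : T.Walk a b, q.IsPath ∧ v ∈ q.support}

/-- Pseudo-degree: the degree of `v` in the subgraph of `T` induced by the trunk vertices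
(`0` if `v` is not a trunk vertex). -/
def pdeg {V : Type*} (S : Set V) (T : SimpleGraph V) (r v : V) : ℕ :=
  {x | v ∈ trunk S T r ∧ x ∈ trunk S T r ∧ T.Adj v x}.ncard

/-- The parameter `k = ln n`, where `n` is the number of vertices. -/
def kpar (V : Type*) [Fintype V] : ℝ := Real.log (Fintype.card V)

/-- `𝒯_R(S)`: an `(S \ R)`-restricted tree cover of the graph `G - R`. There is one tree for each
root `r ∈ S \ R`; the values of `tree` at other vertices are irrelevant. -/
structure TreeCover {V : Type*} [Fintype V] (G : SimpleGraph V) (wt : Sym2 V → ℝ) (R S : Set V) where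
  tree : V → SimpleGraph V
  isTree : ∀ r ∈ S \ R, IsRootedTreeIn G Rᶜ (tree r) r
  stretch : ∀ a ∈ S \ R, ∀ b ∈ Rᶜ, wdist G wt Rᶜ a b < ⊤ →
    ∃ r ∈ S \ R, a ∈ treeVerts (tree r) r ∧ b ∈ treeVerts (tree r) r ∧
      depth wt (tree r) r a + depth wt (tree r) r b
        ≤ ENNReal.ofReal (2 * kpar V - 1) * wdist G wt Rᶜ a b
  overlap : ∀ v ∈ Rᶜ, ({r | r ∈ S \ R ∧ v ∈ treeVerts (tree r) r}.ncard : ℝ)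
    ≤ 2 * Real.exp 1 * (Real.log (Fintype.card V)) ^ 2

/-- The degree threshold `4e d^(c+1) ln² n + 1`. -/
def degThreshold (V : Type*) [Fintype V] (d : ℕ) (c : ℝ) : ℝ :=
  4 * Real.exp 1 * (d : ℝ) ^ (c + 1) * (Real.log (Fintype.card V)) ^ 2 + 1

/-- `Hi(𝒯_R(S))`: vertices whose pseudo-degree exceeds the threshold in some tree of the cover. -/
def Hi {V : Type*} [Fintype V] {G : SimpleGraph V} {wt : Sym2 V → ℝ}
    (d : ℕ) (c : ℝ) {R S : Set V} (C : TreeCover G wt R S) : Set V :=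
  {v | ∃ r ∈ S \ R, v ∈ treeVerts (C.tree r) r ∧
    degThreshold V d c < (pdeg (S \ R) (C.tree r) r v : ℝ)}

/-- The sets `W_0 = ∅`, `W_{j+1} = W_j ∪ Hi(𝒯_{W_j}(A))`. The children of a non-leaf node `A` of
the hierarchy tree are `W_1, …, W_d`; note that `W_1 = Hi(𝒯_∅(A)) = Hi(𝒯(A))`. -/
def childSet {V : Type*} [Fintype V] {G : SimpleGraph V} {wt : Sym2 V → ℝ}
    (𝒯 : ∀ R S : Set V, TreeCover G wt R S) (d : ℕ) (c : ℝ) (A : Set V) : ℕ → Set V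
  | 0 => ∅
  | j + 1 => childSet 𝒯 d c A j ∪ Hi d c (𝒯 (childSet 𝒯 d c A j) A)

/-- `U 1, …, U p` is a path in the hierarchy tree that starts at the root `V`; moreover
`U (p+1) = ∅` by convention. (Other values of `U` are irrelevant.)
A node is a leaf if and only if `Hi` of its tree cover is empty. -/
structure IsHierarchyPath {V : Type*} [Fintype V] {G : SimpleGraph V} {wt : Sym2 V → ℝ}
    (𝒯 : ∀ R S : Set V, TreeCover G wt R S) (d : ℕ) (c : ℝ)
    (U : ℕ → Set V) (p : ℕ) : Prop where
  one_le : 1 ≤ p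
  root : U 1 = Set.univ
  child : ∀ i, 1 ≤ i → i < p → (Hi d c (𝒯 ∅ (U i))).Nonempty ∧
    ∃ j, 1 ≤ j ∧ j ≤ d ∧ U (i + 1) = childSet 𝒯 d c (U i) j
  last : U (p + 1) = ∅

open Classical in
/-- The level of `v`: the largest `l ≤ p` with `v ∈ U l` (it is at least `1` because
`U 1` contains all vertices). -/
def level {V : Type*} (U : ℕ → Set V) (p : ℕ) (v : V) : ℕ :=
  Nat.findGreatest (fun l => v ∈ U l) p

/-- The vertex set of the graph `G_i`: all vertices of level at most `i`. -/
def levelSet {V : Type*} (U : ℕ → Set V) (p i : ℕ) : Set V := {v | level U p v ≤ i}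

/-- `N(f)`: over all trees `T` in `⋃_{1 ≤ i ≤ p} 𝒯_{U_{i+1}}(U_i)` that contain `f`,
the parent of `f` in `T` (if `f` is not the root of `T`) and those children of `f` in `T` that are
trunk vertices of `T`. -/
def failNbrs {V : Type*} [Fintype V] {G : SimpleGraph V} {wt : Sym2 V → ℝ}
    (𝒯 : ∀ R S : Set V, TreeCover G wt R S) (U : ℕ → Set V) (p : ℕ) (f : V) : Set V :=
  {x | ∃ i, 1 ≤ i ∧ i ≤ p ∧ ∃ r ∈ U i \ U (i + 1),
    f ∈ treeVerts ((𝒯 (U (i + 1)) (U i)).tree r) r ∧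
    (IsParent ((𝒯 (U (i + 1)) (U i)).tree r) r x f ∨
      (IsParent ((𝒯 (U (i + 1)) (U i)).tree r) r f x ∧
        x ∈ trunk (U i \ U (i + 1)) ((𝒯 (U (i + 1)) (U i)).tree r) r))}

/-- The vertex set `V(H)` of the auxiliary graph for the query `(s, t, D)`. -/
def auxVerts {V : Type*} [Fintype V] {G : SimpleGraph V} {wt : Sym2 V → ℝ}
    (𝒯 : ∀ R S : Set V, TreeCover G wt R S) (U : ℕ → Set V) (p : ℕ)
    (D : Set V) (s t : V) : Set V :=
  ({s, t} ∪ ⋃ f ∈ D, failNbrs 𝒯 U p f) \ D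

/-- The walk `P` from `u` to `v` is `ε`-far away from the vertex set `N`, where distances to `N`
are measured in `G - D`. -/
def IsFar {V : Type*} {G : SimpleGraph V}
    (wt : Sym2 V → ℝ) (D : Set V) (ε : ℝ) (N : Set V) {u v : V} (P : G.Walk u v) : Prop :=
  ¬ ∃ i, 1 ≤ i ∧ i < P.length ∧ ∃ w ∈ N, wdist G wt Dᶜ (P.getVert i) w
    ≤ ENNReal.ofReal (ε * min (wlen wt (P.take i)) (wlen wt (P.drop i)))

/-- The `i`-th and the `j`-th vertex of `P` are interior and lie in the same `ε`-segment. -/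
def SameSegment {V : Type*} {G : SimpleGraph V}
    (wt : Sym2 V → ℝ) (ε : ℝ) {u v : V} (P : G.Walk u v) (i j : ℕ) : Prop :=
  1 ≤ i ∧ i < P.length ∧ 1 ≤ j ∧ j < P.length ∧
  ((wlen wt (P.take i) ≤ wlen wt P / 2 ∧ wlen wt (P.take j) ≤ wlen wt P / 2 ∧
      ⌊Real.logb (1 + ε) (wlen wt (P.take i))⌋ = ⌊Real.logb (1 + ε) (wlen wt (P.take j))⌋) ∨
   (wlen wt (P.drop i) < wlen wt P / 2 ∧ wlen wt (P.drop j) < wlen wt P / 2 ∧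
      ⌊Real.logb (1 + ε) (wlen wt (P.drop i))⌋ = ⌊Real.logb (1 + ε) (wlen wt (P.drop j))⌋))

/-- The `a`-th vertex of `P` is the leftmost and the `b`-th vertex is the rightmost vertex of one
and the same `ε`-segment of `P`. -/
def IsSegment {V : Type*} {G : SimpleGraph V}
    (wt : Sym2 V → ℝ) (ε : ℝ) {u v : V} (P : G.Walk u v) (a b : ℕ) : Prop :=
  SameSegment wt ε P a b ∧ ∀ j, SameSegment wt ε P a j → a ≤ j ∧ j ≤ b

/-- `P` is an `ε`-segment expath: a path in `G` each of whose `ε`-segments is a shortest path in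
some `G_i`, `1 ≤ i ≤ p`. -/
def IsSegmentExpath {V : Type*} {G : SimpleGraph V}
    (wt : Sym2 V → ℝ) (U : ℕ → Set V) (p : ℕ) (ε : ℝ) {u v : V}
    (P : G.Walk u v) : Prop :=
  P.IsPath ∧ ∀ a b, IsSegment wt ε P a b →
    ∃ i, 1 ≤ i ∧ i ≤ p ∧ IsShortestPathIn wt (levelSet U p i) ((P.drop a).take (b - a))

end

end VSDO

/-!
Let `i` be the highest level on a segment `Q` of `P`, attained at `z`. If `Q` is not shortest in
`G_i`, a shorter walk of `G_i` with the same ends must meet some `f ∈ D`, because `P` is shortest in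
`G - D`; going along the two walks in the better direction, `f` has distance less than `|Q|` from
`z`. Since `z ∈ U_i` while `G_i` avoids `U_{i+1}`, some tree of `𝒯_{U_{i+1}}(U_i)` contains both `z`
and `f`, with depths summing up to less than `(2k - 1)|Q|`. On the way from `z` to `f` through the
root, the last vertex before `D` is either a trunk child (on the way up) or the parent (on the way
down) of a vertex of `D`, so it is in `V(H)`. As `|Q|` is at most `ε₄` times the distance of `z`
to the nearer end of `P`, this contradicts that `P` is far from `V(H)`.
-/

namespace VSDO

open SimpleGraph

section Walks

variable {V : Type*} {G : SimpleGraph V} {wt : Sym2 V → ℝ} {A B : Set V} {x y z : V}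

@[simp]
lemma wlen_append (p : G.Walk x y) (q : G.Walk y z) :
    wlen wt (p.append q) = wlen wt p + wlen wt q := by
  simp [wlen]

@[simp]
lemma wlen_reverse (p : G.Walk x y) : wlen wt p.reverse = wlen wt p := by
  simp [wlen]

@[simp]
lemma wlen_mapLe {T : SimpleGraph V} (h : T ≤ G) (p : T.Walk x y) :
    wlen wt (p.mapLe h) = wlen wt p := by
  simp [wlen]

lemma wlen_nonneg (hwt : ∀ e ∈ G.edgeSet, 0 ≤ wt e) (p : G.Walk x y) : 0 ≤ wlen wt p :=
  List.sum_nonneg <| List.forall_mem_map.2 fun e he ↦ hwt e (p.edges_subset_edgeSet he)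

lemma wlen_pos (hwt : ∀ e ∈ G.edgeSet, 0 < wt e) {p : G.Walk x y} (hp : 0 < p.length) :
    0 < wlen wt p := by
  refine List.sum_pos _ (List.forall_mem_map.2 fun e he ↦ hwt e (p.edges_subset_edgeSet he)) ?_
  rwa [← List.length_pos_iff, List.length_map, Walk.length_edges]

lemma wlen_le_of_edges_sublist (hwt : ∀ e ∈ G.edgeSet, 0 ≤ wt e) {x' y' : V} {q : G.Walk x' y'}
    {p : G.Walk x y} (h : q.edges.Sublist p.edges) : wlen wt q ≤ wlen wt p :=
  (h.map wt).sum_le_sum <| List.forall_mem_map.2 fun e he ↦ hwt e (p.edges_subset_edgeSet he)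

lemma wlen_le_of_isSubwalk (hwt : ∀ e ∈ G.edgeSet, 0 ≤ wt e) {x' y' : V} {q : G.Walk x' y'}
    {p : G.Walk x y} (h : q.IsSubwalk p) : wlen wt q ≤ wlen wt p :=
  wlen_le_of_edges_sublist hwt h.edges_isInfix.sublist

lemma wlen_take_add_wlen_drop (p : G.Walk x y) (n : ℕ) :
    wlen wt (p.take n) + wlen wt (p.drop n) = wlen wt p := by
  rw [← wlen_append, Walk.append_take_drop_eq]

lemma wlen_drop_drop (p : G.Walk x y) (n m : ℕ) :
    wlen wt ((p.drop n).drop m) = wlen wt (p.drop (n + m)) := by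
  simp only [wlen, Walk.edges_drop, List.drop_drop]

lemma exists_getVert_eq_of_mem_support_take_drop {p : G.Walk x y} {a n : ℕ}
    (hz : z ∈ ((p.drop a).take n).support) : ∃ m, a ≤ m ∧ m ≤ a + n ∧ p.getVert m = z := by
  obtain ⟨l, hl, -⟩ := Walk.mem_support_iff_exists_getVert.1 hz
  rw [Walk.take_getVert, Walk.drop_getVert] at hl
  exact ⟨a + n ⊓ l, by omega, by omega, hl⟩

lemma StaysIn.append {p : G.Walk x y} {q : G.Walk y z} (hp : StaysIn A p) (hq : StaysIn A q) :
    StaysIn A (p.append q) :=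
  fun w hw ↦ ((Walk.mem_support_append_iff p q).1 hw).elim (hp w) (hq w)

lemma StaysIn.reverse {p : G.Walk x y} (h : StaysIn A p) : StaysIn A p.reverse :=
  fun w hw ↦ h w (by simpa using hw)

lemma StaysIn.mapLe {T : SimpleGraph V} {p : T.Walk x y} (h : StaysIn A p) (hT : T ≤ G) :
    StaysIn A (p.mapLe hT) :=
  fun w hw ↦ h w (by simpa using hw)

lemma StaysIn.of_isSubwalk {x' y' : V} {p : G.Walk x y} {q : G.Walk x' y'} (h : StaysIn A p)
    (hqp : q.IsSubwalk p) : StaysIn A q :=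
  fun w hw ↦ h w (hqp.support_subset hw)

lemma exists_eq_append_cons_first_mem {D : Set V} (p : G.Walk x y) (hx : x ∉ D)
    (hpD : ∃ z ∈ p.support, z ∈ D) :
    ∃ (w f : V) (q : G.Walk x w) (h : G.Adj w f) (r : G.Walk f y),
      f ∈ D ∧ StaysIn Dᶜ q ∧ p = q.append (Walk.cons h r) := by
  induction p with
  | nil => simp_all
  | @cons x b y h r ih =>
    by_cases hb : b ∈ D
    · exact ⟨x, b, .nil, h, r, hb, by simpa [StaysIn] using hx, rfl⟩
    · have hrD : ∃ z ∈ r.support, z ∈ D := by simpa [hx] using hpD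
      obtain ⟨w, f, q, h', r', hf, hq, rfl⟩ := ih hb hrD
      exact ⟨w, f, .cons h q, h', r', hf, by simpa [StaysIn, hx] using hq, rfl⟩

lemma wdist_le {p : G.Walk x y} (hp : StaysIn A p) :
    wdist G wt A x y ≤ ENNReal.ofReal (wlen wt p) :=
  iInf_le (fun p : {p : G.Walk x y // StaysIn A p} ↦ ENNReal.ofReal (wlen wt p.1)) ⟨p, hp⟩

lemma wdist_lt_ofReal (hwt : ∀ e ∈ G.edgeSet, 0 ≤ wt e) {p : G.Walk x y} (hp : StaysIn A p)
    {M : ℝ} (hpM : wlen wt p < M) : wdist G wt A x y < ENNReal.ofReal M :=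
  (wdist_le hp).trans_lt <| (ENNReal.ofReal_lt_ofReal_iff_of_nonneg (wlen_nonneg hwt p)).2 hpM

lemma wdist_anti (h : A ⊆ B) : wdist G wt B x y ≤ wdist G wt A x y :=
  le_iInf fun p ↦ wdist_le fun z hz ↦ h (p.2 z hz)

lemma exists_isPath_of_wdist_add_lt (hwt : ∀ e ∈ G.edgeSet, 0 ≤ wt e) {x' y' : V} {M : ℝ}
    (h : wdist G wt A x y + wdist G wt B x' y' < ENNReal.ofReal M) :
    ∃ (p : G.Walk x y) (q : G.Walk x' y'), p.IsPath ∧ q.IsPath ∧ wlen wt p + wlen wt q < M := by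
  classical
  by_contra! hM
  refine h.not_ge (ENNReal.le_iInf_add_iInf fun p q ↦ ?_)
  rw [← ENNReal.ofReal_add (wlen_nonneg hwt _) (wlen_nonneg hwt _)]
  refine ENNReal.ofReal_le_ofReal ?_
  calc M ≤ wlen wt p.1.bypass + wlen wt q.1.bypass :=
        hM _ _ p.1.bypass_isPath q.1.bypass_isPath
    _ ≤ wlen wt p.1 + wlen wt q.1 :=
        add_le_add (wlen_le_of_edges_sublist hwt p.1.edges_bypass_sublist_edges)
          (wlen_le_of_edges_sublist hwt q.1.edges_bypass_sublist_edges)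

lemma wdist_lt_of_mem_support_of_wlen_lt (hwt : ∀ e ∈ G.edgeSet, 0 ≤ wt e) {f : V}
    {p q : G.Walk x y} (hp : StaysIn A p) (hq : StaysIn A q) (hqp : wlen wt q < wlen wt p)
    (hz : z ∈ p.support) (hf : f ∈ q.support) :
    wdist G wt A z f < ENNReal.ofReal (wlen wt p) := by
  obtain ⟨p₁, p₂, rfl⟩ := Walk.mem_support_iff_exists_append.1 hz
  obtain ⟨q₁, q₂, rfl⟩ := Walk.mem_support_iff_exists_append.1 hf
  have hleft : StaysIn A (p₁.reverse.append q₁) :=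
    (hp.of_isSubwalk ⟨.nil, p₂, rfl⟩).reverse.append (hq.of_isSubwalk ⟨.nil, q₂, rfl⟩)
  have hright : StaysIn A (p₂.append q₂.reverse) :=
    (hp.of_isSubwalk ⟨p₁, .nil, by simp⟩).append (hq.of_isSubwalk ⟨q₁, .nil, by simp⟩).reverse
  simp only [wlen_append] at hqp ⊢
  -- The two walks together form a closed walk shorter than `2|p|`.
  rcases le_total (wlen wt p₁ + wlen wt q₁) (wlen wt p₂ + wlen wt q₂) with h | h
  · exact wdist_lt_ofReal hwt hleft (by rw [wlen_append, wlen_reverse]; linarith)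
  · exact wdist_lt_ofReal hwt hright (by rw [wlen_append, wlen_reverse]; linarith)

lemma IsShortestPathIn.exists_notMem_of_wlen_lt {P : G.Walk x y} (hP : IsShortestPathIn wt A P)
    {a n : ℕ} {q : G.Walk (P.getVert a) ((P.drop a).getVert n)}
    (hq : wlen wt q < wlen wt ((P.drop a).take n)) : ∃ f ∈ q.support, f ∉ A := by
  obtain ⟨-, hPA, hmin⟩ := hP
  by_contra! hqA
  have hdrop : StaysIn A (P.drop a) := hPA.of_isSubwalk (P.isSubwalk_drop a)
  have hdetour : wlen wt P ≤ wlen wt ((P.take a).append (q.append ((P.drop a).drop n))) :=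
    hmin _ <| (hPA.of_isSubwalk (P.isSubwalk_take a)).append <|
      StaysIn.append hqA (hdrop.of_isSubwalk (Walk.isSubwalk_drop _ n))
  simp only [wlen_append] at hdetour
  linarith [wlen_take_add_wlen_drop (wt := wt) P a,
    wlen_take_add_wlen_drop (wt := wt) (P.drop a) n]

lemma IsShortestPathIn.exists_notMem_wdist_lt (hwt : ∀ e ∈ G.edgeSet, 0 ≤ wt e)
    {P : G.Walk x y} (hP : IsShortestPathIn wt A P) {a n : ℕ}
    (hB : StaysIn B ((P.drop a).take n)) (hnot : ¬ IsShortestPathIn wt B ((P.drop a).take n))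
    (hz : z ∈ ((P.drop a).take n).support) :
    ∃ f ∈ B, f ∉ A ∧ wdist G wt B z f < ENNReal.ofReal (wlen wt ((P.drop a).take n)) := by
  obtain ⟨q, hqB, hq⟩ : ∃ q, StaysIn B q ∧ wlen wt q < wlen wt ((P.drop a).take n) := by
    by_contra! h
    exact hnot ⟨(hP.1.drop a).take n, hB, h⟩
  obtain ⟨f, hfq, hfA⟩ := hP.exists_notMem_of_wlen_lt hq
  exact ⟨f, hqB f hfq, hfA, wdist_lt_of_mem_support_of_wlen_lt hwt hB hqB hq hz hfq⟩

end Walks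

section Segments

lemma lt_mul_of_floor_logb_eq {b x y : ℝ} (hb : 1 < b) (hx : 0 < x) (hy : 0 < y)
    (h : ⌊Real.logb b x⌋ = ⌊Real.logb b y⌋) : y < b * x := by
  have hxy := (abs_lt.1 (Int.abs_sub_lt_one_of_floor_eq_floor h)).1
  rw [← Real.logb_lt_logb_iff hb hy (by positivity), Real.logb_mul (by positivity) hx.ne',
    Real.logb_self_eq_one hb]
  linarith

lemma SameSegment.wlen_take_drop_le {V : Type*} {G : SimpleGraph V} {wt : Sym2 V → ℝ}
    (hwt : ∀ e ∈ G.edgeSet, 0 < wt e) {δ : ℝ} (hδ : 0 < δ) {u v : V} {P : G.Walk u v}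
    {a b m : ℕ} (h : SameSegment wt δ P a b) (ham : a ≤ m) (hmb : m ≤ b) :
    wlen wt ((P.drop a).take (b - a)) ≤ δ * min (wlen wt (P.take m)) (wlen wt (P.drop m)) := by
  obtain ⟨ha, haP, -, hbP, h⟩ := h
  have hseg := wlen_take_add_wlen_drop (wt := wt) (P.drop a) (b - a)
  rw [wlen_drop_drop, Nat.add_sub_cancel' (ham.trans hmb)] at hseg
  have hPa := wlen_take_add_wlen_drop (wt := wt) P a
  have hPb := wlen_take_add_wlen_drop (wt := wt) P b
  have hPm := wlen_take_add_wlen_drop (wt := wt) P m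
  have ham' := wlen_le_of_isSubwalk (fun e he ↦ (hwt e he).le) (P.take_isSubwalk_take ham)
  have hmb' := wlen_le_of_isSubwalk (fun e he ↦ (hwt e he).le) (P.take_isSubwalk_take hmb)
  have hδ' : 1 < 1 + δ := by linarith
  rcases h with ⟨-, hbhalf, hfloor⟩ | ⟨hahalf, -, hfloor⟩
  · have hapos : 0 < wlen wt (P.take a) := wlen_pos hwt (by simp; omega)
    have hratio : wlen wt (P.take b) < (1 + δ) * wlen wt (P.take a) :=
      lt_mul_of_floor_logb_eq hδ' hapos (by linarith) hfloor
    rw [min_eq_left (by linarith)]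
    nlinarith
  · have hbpos : 0 < wlen wt (P.drop b) := wlen_pos hwt (by simp; omega)
    have hratio : wlen wt (P.drop a) < (1 + δ) * wlen wt (P.drop b) :=
      lt_mul_of_floor_logb_eq hδ' hbpos (by linarith) hfloor.symm
    rw [min_eq_right (by linarith)]
    nlinarith

end Segments

section Levels

variable {V : Type*} {U : ℕ → Set V} {p : ℕ}

lemma one_le_level (hp : 1 ≤ p) (hroot : U 1 = Set.univ) (z : V) : 1 ≤ level U p z := by
  classical
  exact Nat.le_findGreatest hp (by simp [hroot])

lemma level_le (z : V) : level U p z ≤ p := by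
  classical
  exact Nat.findGreatest_le p

lemma mem_level (hp : 1 ≤ p) (hroot : U 1 = Set.univ) (z : V) : z ∈ U (level U p z) := by
  classical
  exact Nat.findGreatest_spec (P := fun l ↦ z ∈ U l) hp (by simp [hroot])

lemma levelSet_subset_compl (hlast : U (p + 1) = ∅) {i : ℕ} (hi : i ≤ p) :
    levelSet U p i ⊆ (U (i + 1))ᶜ := by
  classical
  intro z hz
  rcases hi.eq_or_lt with rfl | hip
  · simp [hlast]
  · exact Nat.findGreatest_is_greatest (P := fun l ↦ z ∈ U l) (Nat.lt_succ_of_le hz) hip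

lemma exists_staysIn_levelSet (U : ℕ → Set V) (p : ℕ) {G : SimpleGraph V} {x y : V}
    (q : G.Walk x y) : ∃ z ∈ q.support, StaysIn (levelSet U p (level U p z)) q := by
  classical
  simpa [StaysIn, levelSet] using q.support.toFinset.exists_max_image (level U p) ⟨x, by simp⟩

end Levels

section Trees

variable {V : Type*} {T : SimpleGraph V} {S D : Set V} {r a b : V}

lemma IsParent.right_mem_treeVerts (h : IsParent T r a b) : b ∈ treeVerts T r :=
  let ⟨_, q, _⟩ := h; ⟨q⟩

lemma IsParent.left_mem_treeVerts (h : IsParent T r a b) : a ∈ treeVerts T r :=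
  Reachable.trans h.right_mem_treeVerts h.1.symm.reachable

lemma exists_isParent_mem_trunk_of_meets {p : T.Walk a r} (hp : p.IsPath) (ha : a ∈ S)
    (hr : r ∈ S) (haD : a ∉ D) (hpD : ∃ z ∈ p.support, z ∈ D) :
    ∃ f ∈ D, ∃ w ∉ D, (IsParent T r f w ∧ w ∈ trunk S T r) ∧
      ∃ q : T.Walk a w, StaysIn Dᶜ q ∧ q.IsSubwalk p := by
  obtain ⟨w, f, q, hwf, q', hf, hq, rfl⟩ := exists_eq_append_cons_first_mem p haD hpD
  have hparent : IsParent T r f w :=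
    ⟨hwf.symm, (Walk.cons hwf q').reverse, hp.of_append_right.reverse, by simp⟩
  exact ⟨f, hf, w, hq w q.end_mem_support,
    ⟨hparent, hparent.right_mem_treeVerts, a, ha, r, hr, _, hp, by simp⟩,
    q, hq, .nil, .cons hwf q', rfl⟩

lemma exists_isParent_of_meets {p : T.Walk r b} (hp : p.IsPath) (hrD : r ∉ D)
    (hpD : ∃ z ∈ p.support, z ∈ D) :
    ∃ f ∈ D, ∃ w ∉ D, IsParent T r w f ∧ ∃ q : T.Walk r w, StaysIn Dᶜ q ∧ q.IsSubwalk p := by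
  obtain ⟨w, f, q, hwf, q', hf, hq, rfl⟩ := exists_eq_append_cons_first_mem p hrD hpD
  have hpath : (q.concat hwf).IsPath :=
    Walk.IsPath.of_append_left (q := q') (by rwa [Walk.concat_append])
  exact ⟨f, hf, w, hq w q.end_mem_support, ⟨hwf, _, hpath, by simp [Walk.support_concat]⟩,
    q, hq, .nil, .cons hwf q', rfl⟩

lemma exists_isParent_wdist_lt_of_depth_add_lt {G : SimpleGraph V} {wt : Sym2 V → ℝ}
    (hwt : ∀ e ∈ G.edgeSet, 0 ≤ wt e) (hT : T ≤ G) (ha : a ∈ S) (hr : r ∈ S) (haD : a ∉ D)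
    (hbD : b ∈ D) {M : ℝ} (hM : depth wt T r a + depth wt T r b < ENNReal.ofReal M) :
    ∃ f ∈ D, ∃ w ∉ D, (IsParent T r w f ∨ IsParent T r f w ∧ w ∈ trunk S T r) ∧
      wdist G wt Dᶜ a w < ENNReal.ofReal M := by
  have hwtT : ∀ e ∈ T.edgeSet, 0 ≤ wt e := fun e he ↦ hwt e (edgeSet_mono hT he)
  obtain ⟨p, q, hp, hq, hpq⟩ := exists_isPath_of_wdist_add_lt hwtT hM
  by_cases hpD : ∃ z ∈ p.support, z ∈ D
  · obtain ⟨f, hf, w, hw, hchild, p', hp'D, hp'⟩ :=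
      exists_isParent_mem_trunk_of_meets hp ha hr haD hpD
    refine ⟨f, hf, w, hw, .inr hchild, wdist_lt_ofReal hwt (hp'D.mapLe hT) ?_⟩
    rw [wlen_mapLe]
    linarith [wlen_le_of_isSubwalk hwtT hp', wlen_nonneg hwtT q]
  · push Not at hpD
    obtain ⟨f, hf, w, hw, hparent, q', hq'D, hq'⟩ := exists_isParent_of_meets hq.reverse
      (hpD r p.end_mem_support) ⟨b, Walk.end_mem_support _, hbD⟩
    have hpq'D : StaysIn Dᶜ (p.append q') := StaysIn.append hpD hq'D
    refine ⟨f, hf, w, hw, .inl hparent, wdist_lt_ofReal hwt (hpq'D.mapLe hT) ?_⟩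
    have hq'le := wlen_le_of_isSubwalk hwtT hq'
    rw [wlen_reverse] at hq'le
    rw [wlen_mapLe, wlen_append]
    linarith

end Trees

section TreeCovers

variable {V : Type*} [Fintype V] {G : SimpleGraph V} {wt : Sym2 V → ℝ}

lemma one_lt_kpar (hn : 3 ≤ Fintype.card V) : 1 < kpar V := by
  have h3 : (3 : ℝ) ≤ Fintype.card V := by exact_mod_cast hn
  rw [kpar, Real.lt_log_iff_exp_lt (by linarith)]
  linarith [Real.exp_one_lt_three]

lemma TreeCover.exists_depth_add_lt {R S : Set V} (C : TreeCover G wt R S)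
    (hk : 0 < 2 * kpar V - 1) {a b : V} (ha : a ∈ S \ R) (hb : b ∉ R) {L : ℝ}
    (hL : wdist G wt Rᶜ a b < ENNReal.ofReal L) :
    ∃ r ∈ S \ R, depth wt (C.tree r) r a + depth wt (C.tree r) r b
      < ENNReal.ofReal ((2 * kpar V - 1) * L) := by
  obtain ⟨r, hr, -, -, hdepth⟩ := C.stretch a ha b hb hL.lt_top
  refine ⟨r, hr, hdepth.trans_lt ?_⟩
  rw [ENNReal.ofReal_mul hk.le]
  exact ENNReal.mul_lt_mul_right (ENNReal.ofReal_pos.2 hk).ne' ENNReal.ofReal_ne_top hL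

lemma exists_failNbrs_of_wdist_lt (hwt : ∀ e ∈ G.edgeSet, 0 ≤ wt e) (hk : 0 < 2 * kpar V - 1)
    (𝒯 : ∀ R S : Set V, TreeCover G wt R S) {U : ℕ → Set V} {p i : ℕ} (hi : 1 ≤ i)
    (hip : i ≤ p) {D : Set V} {a b : V} (ha : a ∈ U i \ U (i + 1)) (haD : a ∉ D)
    (hb : b ∉ U (i + 1)) (hbD : b ∈ D) {L : ℝ}
    (hL : wdist G wt (U (i + 1))ᶜ a b < ENNReal.ofReal L) :
    ∃ f ∈ D, ∃ w ∈ failNbrs 𝒯 U p f \ D,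
      wdist G wt Dᶜ a w < ENNReal.ofReal ((2 * kpar V - 1) * L) := by
  obtain ⟨r, hr, hdepth⟩ := (𝒯 (U (i + 1)) (U i)).exists_depth_add_lt hk ha hb hL
  obtain ⟨f, hf, w, hw, hparent, haw⟩ := exists_isParent_wdist_lt_of_depth_add_lt hwt
    ((𝒯 (U (i + 1)) (U i)).isTree r hr).le ha hr haD hbD hdepth
  exact ⟨f, hf, w, ⟨⟨i, hi, hip, r, hr, hparent.elim IsParent.right_mem_treeVerts
    fun h ↦ h.1.left_mem_treeVerts, hparent⟩, hw⟩, haw⟩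

lemma IsShortestPathIn.exists_failNbrs_wdist_lt (hwt : ∀ e ∈ G.edgeSet, 0 ≤ wt e)
    (hk : 0 < 2 * kpar V - 1) (𝒯 : ∀ R S : Set V, TreeCover G wt R S) {U : ℕ → Set V} {p : ℕ}
    (hp : 1 ≤ p) (hroot : U 1 = Set.univ) (hlast : U (p + 1) = ∅) {D : Set V} {u v z : V}
    {P : G.Walk u v} (hP : IsShortestPathIn wt Dᶜ P) {a n : ℕ}
    (hz : z ∈ ((P.drop a).take n).support)
    (hstay : StaysIn (levelSet U p (level U p z)) ((P.drop a).take n))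
    (hnot : ¬ IsShortestPathIn wt (levelSet U p (level U p z)) ((P.drop a).take n)) :
    ∃ f ∈ D, ∃ w ∈ failNbrs 𝒯 U p f \ D, wdist G wt Dᶜ z w
      < ENNReal.ofReal ((2 * kpar V - 1) * wlen wt ((P.drop a).take n)) := by
  have hsub : levelSet U p (level U p z) ⊆ (U (level U p z + 1))ᶜ :=
    levelSet_subset_compl hlast (level_le z)
  have hzD : z ∉ D :=
    hP.2.1 z <| ((Walk.isSubwalk_take _ n).trans (P.isSubwalk_drop a)).support_subset hz
  obtain ⟨f, hf, hfD, hzf⟩ := hP.exists_notMem_wdist_lt hwt hstay hnot hz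
  exact exists_failNbrs_of_wdist_lt hwt hk 𝒯 (one_le_level hp hroot z) (level_le z)
    ⟨mem_level hp hroot z, hsub (hstay z hz)⟩ hzD (hsub hf) (not_not.1 hfD)
    ((wdist_anti hsub).trans_lt hzf)

lemma failNbrs_diff_subset_auxVerts {𝒯 : ∀ R S : Set V, TreeCover G wt R S} {U : ℕ → Set V}
    {p : ℕ} {D : Set V} {s t f : V} (hf : f ∈ D) :
    failNbrs 𝒯 U p f \ D ⊆ auxVerts 𝒯 U p D s t :=
  Set.sdiff_subset_sdiff_left <|
    (Set.subset_biUnion_of_mem (u := failNbrs 𝒯 U p) hf).trans Set.subset_union_right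

end TreeCovers

end VSDO

theorem mainTheorem2_general {V : Type*} [Fintype V] {G : SimpleGraph V} {wt : Sym2 V → ℝ}
    (hwt : ∀ e ∈ G.edgeSet, 0 < wt e) {𝒯 : ∀ R S : Set V, VSDO.TreeCover G wt R S}
    {U : ℕ → Set V} {p : ℕ} (hp : 1 ≤ p) (hroot : U 1 = Set.univ) (hlast : U (p + 1) = ∅)
    {D N : Set V} (hN : ∀ f ∈ D, VSDO.failNbrs 𝒯 U p f \ D ⊆ N)
    {δ η : ℝ} (hδ : 0 < δ) (hδη : (2 * VSDO.kpar V - 1) * δ ≤ η)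
    {u v : V} {P : G.Walk u v} (hP : VSDO.IsShortestPathIn wt Dᶜ P)
    (hfar : VSDO.IsFar wt D η N P) : VSDO.IsSegmentExpath wt U p δ P := by
  have hwt₀ : ∀ e ∈ G.edgeSet, 0 ≤ wt e := fun e he ↦ (hwt e he).le
  refine ⟨hP.1, fun a b ⟨hab, hextreme⟩ ↦ ?_⟩
  have ⟨ha, _, _, hb, _⟩ := hab
  have hle : a ≤ b := (hextreme b hab).1
  have hcard : 3 ≤ Fintype.card V := by
    have := hP.1.length_lt
    omega
  have hk : 0 < 2 * VSDO.kpar V - 1 := by linarith [VSDO.one_lt_kpar hcard]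
  obtain ⟨z, hz, hstay⟩ := VSDO.exists_staysIn_levelSet U p ((P.drop a).take (b - a))
  refine ⟨VSDO.level U p z, VSDO.one_le_level hp hroot z, VSDO.level_le z, ?_⟩
  by_contra hnot
  obtain ⟨f, hf, w, hw, hzw⟩ := hP.exists_failNbrs_wdist_lt hwt₀ hk 𝒯 hp hroot hlast hz
    hstay hnot
  obtain ⟨m, ham, hmb, rfl⟩ := VSDO.exists_getVert_eq_of_mem_support_take_drop hz
  have hmb' : m ≤ b := by omega
  refine hfar ⟨m, ha.trans ham, hmb'.trans_lt hb, w, hN f hf hw,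
    hzw.le.trans (ENNReal.ofReal_le_ofReal ?_)⟩
  have hmin : 0 ≤ min (VSDO.wlen wt (P.take m)) (VSDO.wlen wt (P.drop m)) :=
    le_min (VSDO.wlen_nonneg hwt₀ _) (VSDO.wlen_nonneg hwt₀ _)
  calc (2 * VSDO.kpar V - 1) * VSDO.wlen wt ((P.drop a).take (b - a))
      ≤ (2 * VSDO.kpar V - 1) *
          (δ * min (VSDO.wlen wt (P.take m)) (VSDO.wlen wt (P.drop m))) := by
        gcongr
        exact hab.wlen_take_drop_le hwt hδ ham hmb'
    _ ≤ η * min (VSDO.wlen wt (P.take m)) (VSDO.wlen wt (P.drop m)) := by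
        rw [← mul_assoc]
        gcongr

theorem mainTheorem2 {V : Type*} [Fintype V] (G : SimpleGraph V) (wt : Sym2 V → ℝ)
    (hwt : ∀ e ∈ G.edgeSet, 0 < wt e) (hn : 3 ≤ Fintype.card V)
    (d : ℕ) (hd : 2 ≤ d) (c : ℝ) (hc : 1 ≤ c)
    (𝒯 : ∀ R S : Set V, VSDO.TreeCover G wt R S)
    (U : ℕ → Set V) (p : ℕ) (hU : VSDO.IsHierarchyPath 𝒯 d c U p)
    (D : Set V) (hD : D.ncard ≤ d) (s t : V) (hs : s ∉ D) (ht : t ∉ D)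
    (ε ε₃ ε₄ : ℝ) (hε : 0 < ε)
    (hε₃ : ε₃ = ε / (2 * ((VSDO.auxVerts 𝒯 U p D s t).ncard : ℝ)))
    (hε₄ : ε₄ = ε₃ / (4 * VSDO.kpar V - 2))
    (u v : V) (hu : u ∈ VSDO.auxVerts 𝒯 U p D s t) (hv : v ∈ VSDO.auxVerts 𝒯 U p D s t)
    (P : G.Walk u v) (hP : VSDO.IsShortestPathIn wt Dᶜ P)
    (hfar : VSDO.IsFar wt D ε₃ (VSDO.auxVerts 𝒯 U p D s t) P) :
    VSDO.IsSegmentExpath wt U p ε₄ P := by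
  have hk := VSDO.one_lt_kpar hn
  have hcard : (0 : ℝ) < (VSDO.auxVerts 𝒯 U p D s t).ncard :=
    mod_cast (Set.ncard_pos (Set.toFinite _)).2 ⟨u, hu⟩
  have hε₃pos : 0 < ε₃ := by rw [hε₃]; positivity
  have hε₄pos : 0 < ε₄ := by rw [hε₄]; exact div_pos hε₃pos (by linarith)
  have hε₄ε₃ : (2 * VSDO.kpar V - 1) * ε₄ ≤ ε₃ := by
    have : ε₄ * (4 * VSDO.kpar V - 2) = ε₃ := by rw [hε₄]; exact div_mul_cancel₀ _ (by linarith)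
    linarith
  exact mainTheorem2_general hwt hU.one_le hU.root hU.last
    (fun f hf ↦ VSDO.failNbrs_diff_subset_auxVerts hf) hε₄pos hε₄ε₃ hP hfar
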